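/- **Setting.** Let $\mathcal X$ be a set, $\mathcal D\subseteq\mathbb R$ a convex set of decisions, $\mathcal Y\subseteq\mathbb R$ a set of outcomes, and $\ell$ a loss such that, for every $y\in\mathcal Y$, $\ell(\cdot,y)$ is convex and $L$-Lipschitz on $\mathcal D$. In round $t=1,\dots,n$ Nature reveals $x_t\in\mathcal X$, the learner chooses a distribution $q_t$ on $\mathcal D$ (a function of $x_{1:t},y_{1:t-1}$), Nature reveals $y_t\in\mathcal Y$, and the learner draws $\hat y_t\sim q_t$ and suffers $\ell(\hat y_t,y_t)$. A rate $\mathcal B_n(f)$ is *achievable* for $\mathcal F\subseteq\mathcal D^{\mathcal X}$ if there is a randomized strategy $(q_t)$ of this kind, with well-defined expected losses, such that for all $x_{1:n}$, $y_{1:n}$ and all $f\in\mathcal F$ $$\mathbb E\Big[\sum_{t=1}^n\ell(\hat y_t,y_t)-\sum_{t=1}^n\ell(f(x_t),y_t)\Big]\le \mathcal B_n(f).$$ A $\mathcal Z$-valued tree $\mathbf z$ of depth $n$ is a sequence of maps $\mathbf z_t:\{\pm1\}^{t-1}\to\mathcal Z$, $t=1,\dots,n$; write $\mathbf z_t(\epsilon)=\mathbf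 z_t(\epsilon_1,\dots,\epsilon_{t-1})$. For $\mathcal G\subseteq\mathbb R^{\mathcal Z}$ let $$\mathrm{Rad}_n(\mathcal G)=\sup_{\mathbf z}\mathbb E_\epsilon\sup_{g\in\mathcal G}\sum_{t=1}^n\epsilon_t g(\mathbf z_t(\epsilon)),$$ where $\epsilon$ is uniform on $\{\pm1\}^n$, and let $\mathcal N_\infty(\mathcal G,\alpha,n)=\sup_{\mathbf z}\mathcal N_\infty(\mathcal G,\alpha,\mathbf z)$, where $\mathcal N_\infty(\mathcal G,\alpha,\mathbf z)$ is the smallest size of a set $V$ of real-valued trees such that for all $g\in\mathcal G$ and $\epsilon\in\{\pm1\}^n$ there is $\mathbf v\in V$ with $|g(\mathbf z_t(\epsilon))-\mathbf v_t(\epsilon)|\le\alpha$ for all $t\le n$. Let $\mathcal F=\bigcup_{R\ge1}\mathcal F(R)$, where $\mathcal F(R)\subseteq\mathcal D^{\mathcal X}$, $\mathcal F(R)\subseteq\mathcal F(R')$ for $1\le R\le R'$, and each $\mathcal F(R)$ is uniformly bounded. For $f\in\mathcal F$ let $R(f)=\inf\{R\ge1: f\in\mathcal F(R)\}$. **Theorem.**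 There are absolute constants $K_1,K_2>0$ such that, in every such setting, for every $n\ge2$ and every real $\Gamma$ with $\Gamma\ge\sum_{j=1}^\infty\mathcal N_\infty(\mathcal F(1),2^{-j},n)^{-1}$, the following rate is achievable for $\mathcal F$: $$\mathcal B_n(f)=L\left(K_1\,\mathrm{Rad}_n(\mathcal F(2R(f)))\,\log^{3/2}n\left(1+\sqrt{\Big[\log\frac{\mathrm{Rad}_n(\mathcal F(2R(f)))}{\mathrm{Rad}_n(\mathcal F(1))}+\log\log(2R(f))\Big]_+}\right)+K_2\,\Gamma\,\mathrm{Rad}_n(\mathcal F(1))\,\log^{3/2}n\right),$$ where $[u]_+=\max\{u,0\}$. (The hypothesis on $\Gamma$ forces $\mathrm{Rad}_n(\mathcal F(1))>0$.) -/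

import Mathlib

open scoped NNReal ENNReal BigOperators

noncomputable section

namespace AdaptiveOnline

/-! ### Binary trees, sequential Rademacher complexity, sequential covering numbers -/

/-- A `Z`-valued tree of depth `n`: a sequence of maps `z_t : {±1}^{t-1} → Z`.
The rounds are indexed from `0`, and a sign is a Boolean (`true` for `+1`, `false` for `-1`). -/
def SignTree (n : ℕ) (Z : Type*) : Type _ := (t : Fin n) → (Fin (t : ℕ) → Bool) → Z

/-- The real sign `±1`. -/
def sgn (b : Bool) : ℝ := if b then 1 else -1

/-- The first `t` entries of a sequence of length `n`. -/
def initial {n : ℕ} {S : Type*} (s : Fin n → S) (t : Fin n) : Fin (t : ℕ) → S :=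
  fun i => s (Fin.castLE t.isLt.le i)

/-- The entries of a sequence of length `n` up to and including the one at time `t`. -/
def initialIncl {n : ℕ} {S : Type*} (s : Fin n → S) (t : Fin n) : Fin ((t : ℕ) + 1) → S :=
  fun i => s (Fin.castLE t.isLt i)

/-- The label `z_t(ε)` of the tree at time `t` along the path `ε`. -/
def SignTree.label {n : ℕ} {Z : Type*} (z : SignTree n Z) (ε : Fin n → Bool) (t : Fin n) : Z :=
  z t (initial ε t)

/-- `Rad_n(G, z) = E_ε sup_{g ∈ G} ∑_t ε_t g(z_t(ε))`, with `ε` uniform on `{±1}^n`.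
(The suprema are genuine for nonempty, uniformly bounded classes.) -/
def radTree {n : ℕ} {Z : Type*} (G : Set (Z → ℝ)) (z : SignTree n Z) : ℝ :=
  (∑ ε : Fin n → Bool, ⨆ g : G, ∑ t : Fin n, sgn (ε t) * (g : Z → ℝ) (z.label ε t)) / 2 ^ n

/-- The sequential Rademacher complexity `Rad_n(G) = sup_z Rad_n(G, z)`. -/
def rad (n : ℕ) {Z : Type*} (G : Set (Z → ℝ)) : ℝ :=
  ⨆ z : SignTree n Z, radTree G z

/-- `V` is an `α`-cover of `G` on the tree `z` with respect to `ℓ_∞`. -/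
def IsSupCover {n : ℕ} {Z : Type*} (G : Set (Z → ℝ)) (α : ℝ) (z : SignTree n Z)
    (V : Set (SignTree n ℝ)) : Prop :=
  ∀ g ∈ G, ∀ ε : Fin n → Bool, ∃ v ∈ V, ∀ t : Fin n, |g (z.label ε t) - v.label ε t| ≤ α

/-- `N_∞(G, α, z)`: the smallest size of an `α`-cover. -/
def coveringTree {n : ℕ} {Z : Type*} (G : Set (Z → ℝ)) (α : ℝ) (z : SignTree n Z) : ℕ∞ :=
  ⨅ (V : Set (SignTree n ℝ)) (_ : IsSupCover G α z V), V.encard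

/-- `N_∞(G, α, n) = sup_z N_∞(G, α, z)`. -/
def covering {Z : Type*} (G : Set (Z → ℝ)) (α : ℝ) (n : ℕ) : ℕ∞ :=
  ⨆ z : SignTree n Z, coveringTree G α z

/-- `∑_{j ≥ 1} N_∞(G, 2^{-j}, n)^{-1}`, possibly infinite. -/
def coveringSum {Z : Type*} (G : Set (Z → ℝ)) (n : ℕ) : ℝ≥0∞ :=
  ∑' j : ℕ, ((covering G ((2 : ℝ) ^ (j + 1))⁻¹ n : ℕ∞) : ℝ≥0∞)⁻¹

/-! ### The online protocol and achievable adaptive rates -/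

/-- A randomized strategy of the learner for `n` rounds: in each round, a distribution over
decisions chosen from the instances up to and including the present one and the past outcomes. -/
def Strategy (n : ℕ) (X D Y : Type*) [MeasurableSpace D] : Type _ :=
  (t : Fin n) → (Fin ((t : ℕ) + 1) → X) → (Fin (t : ℕ) → Y) → MeasureTheory.ProbabilityMeasure D

/-- The distribution `q_t` which the strategy plays in round `t` on the given sequences. -/
def Strategy.play {n : ℕ} {X D Y : Type*} [MeasurableSpace D] (q : Strategy n X D Y)
    (x : Fin n → X) (y : Fin n → Y) (t : Fin n) : MeasureTheory.Measure D :=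
  (q t (initialIncl x t) (initial y t) : MeasureTheory.Measure D)

/-- The adaptive rate `B(f; x_{1:n}, y_{1:n})` is achievable for the class `F` and the loss `ℓ`:
some randomized strategy has, on all sequences and against all `f ∈ F`, well-defined expected
losses and an expected regret of at most `B(f; x_{1:n}, y_{1:n})`. -/
def Achievable {n : ℕ} {X D Y : Type*} [MeasurableSpace D] (loss : D → Y → ℝ)
    (F : Set (X → D)) (B : (X → D) → (Fin n → X) → (Fin n → Y) → ℝ) : Prop :=
  ∃ q : Strategy n X D Y, ∀ (x : Fin n → X) (y : Fin n → Y),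
    (∀ t : Fin n, MeasureTheory.Integrable (fun d => loss d (y t)) (q.play x y t)) ∧
    ∀ f ∈ F,
      (∑ t : Fin n, ∫ d, loss d (y t) ∂(q.play x y t)) - ∑ t : Fin n, loss (f (x t)) (y t)
        ≤ B f x y

/-! ### Nested classes and the model-selection rate -/

/-- A class of predictors with decisions in `D ⊆ ℝ`, seen as a class of real-valued functions. -/
def realClass {X : Type*} {D : Set ℝ} (F : Set (X → D)) : Set (X → ℝ) :=
  (fun (f : X → D) (x : X) => (f x : ℝ)) '' F

/-- The complexity radius `R(f) = inf {R ≥ 1 : f ∈ F(R)}`. -/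
def radius {X D : Type*} (F : ℝ → Set (X → D)) (f : X → D) : ℝ :=
  sInf {R : ℝ | 1 ≤ R ∧ f ∈ F R}

/-- The union `F = ⋃_{R ≥ 1} F(R)`. -/
def unionClass {X D : Type*} (F : ℝ → Set (X → D)) : Set (X → D) :=
  ⋃ R ∈ Set.Ici (1 : ℝ), F R

/-- `K₁ Rad_n(F(2R(f))) log^{3/2} n (1 + √(log (Rad_n(F(2R(f))) / Rad_n(F(1))) + log log 2R(f)))
+ K₂ Γ Rad_n(F(1)) log^{3/2} n`. The real square root vanishes on negative numbers, so that a
negative radicand (possible for `2R(f) < e` only) counts as `0`. -/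
def modelRate (n : ℕ) (K₁ K₂ Γ : ℝ) {X : Type*} {D : Set ℝ} (F : ℝ → Set (X → D))
    (f : X → D) : ℝ :=
  K₁ * rad n (realClass (F (2 * radius F f))) * Real.log n ^ (3 / 2 : ℝ) *
      (1 + √(Real.log (rad n (realClass (F (2 * radius F f))) / rad n (realClass (F 1)))
        + Real.log (Real.log (2 * radius F f))))
    + K₂ * Γ * rad n (realClass (F 1)) * Real.log n ^ (3 / 2 : ℝ)

end AdaptiveOnline

end

open scoped NNReal ENNReal BigOperators

noncomputable section

namespace AdaptiveOnline

/-! ### The value of the linear game -/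

section GameValue

variable {ι X : Type*}

/-! By convexity the regret is at most `L` times the regret for linear losses `s * d`, where the
subgradient slopes satisfy `|s| ≤ 1`. In the linear game the slopes can be replaced by fair signs:
the value is convex in the accumulated gains, so at an intermediate slope it lies below the chord
between slopes `±1`. A decision near the centre plus half the difference of the two extreme values
then keeps the value from growing, and a convex `D` comes arbitrarily close to that point
(`exists_decision`).

It remains to bound the value when the competitors are the pairs of a level `i` and some `f ∈ F (2 ^
(i + 1))`, penalised by level. Let `r i` be the Rademacher complexity of the level and `r₀` that of
`F 1`. The unpenalised value of level `i` is at most `r i`. A random walk on a single instance shows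
that the level has diameter at most `8 * r i / √n`, so by a Hoeffding step in each round the value
is subgaussian at scale `r i`, with no loss in `n`. With the penalty `r i * (1 + 33 * η)`, where `η
^ 2 = 1 + log (r i / r₀) + 2 * log (i + 1)`, level `i` contributes at most `r₀ / (i + 1) ^ 2` to an
exponential potential that dominates the whole game. The total is of order `r₀`, and the regret
against `f` is essentially the penalty of the dyadic level just above `R(f)`.

The factor `log^{3/2} n` enters only through its lower bound at `n = 2`; the covering hypothesis
yields `0 < r₀` and `0 < Γ`. -/

/-- The value, with `k` rounds to go and accumulated gains `a`, of the game in which Nature picks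
`x`, a fair sign is drawn and the gain `± φ x f` is credited to each competitor `f`; the final payoff
is the largest penalised gain `a f - B f` over the competitors in `S`. -/
def gameValue (S : Set ι) (B : ι → ℝ) (φ : X → ι → ℝ) : ℕ → (ι → ℝ) → ℝ
  | 0, a => ⨆ f : S, (a f - B f)
  | k + 1, a => ⨆ x : X, (gameValue S B φ k (a + φ x) + gameValue S B φ k (a - φ x)) / 2

/-- The gains `a` can be accumulated in `j` rounds when the gains per round are at most `c`. -/
def Admissible (c : ι → ℝ) (j : ℕ) (a : ι → ℝ) : Prop := ∀ f, |a f| ≤ j * c f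

variable {c : ι → ℝ} {φ : X → ι → ℝ} {S : Set ι} {B : ι → ℝ} {M : ℝ} {n : ℕ}

theorem admissible_zero : Admissible c 0 0 := fun f => by simp

theorem Admissible.add {j : ℕ} {a b : ι → ℝ} (ha : Admissible c j a) (hb : ∀ f, |b f| ≤ c f) :
    Admissible c (j + 1) (a + b) := fun f => by
  have := abs_add_le (a f) (b f)
  have h1 := ha f
  have h2 := hb f
  push_cast
  simp only [Pi.add_apply]
  linarith

theorem Admissible.sub {j : ℕ} {a b : ι → ℝ} (ha : Admissible c j a) (hb : ∀ f, |b f| ≤ c f) :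
    Admissible c (j + 1) (a - b) := by
  rw [sub_eq_add_neg]
  exact ha.add fun f => by simpa using hb f

theorem le_of_admissible {a : ι → ℝ} (hM : ∀ f ∈ S, n * c f - B f ≤ M) (ha : Admissible c n a)
    (f : S) : a f - B f ≤ M := by
  have := hM f f.2
  have h1 := (abs_le.1 (ha f)).2
  linarith

theorem gameValue_le [Nonempty X] (hφ : ∀ x f, |φ x f| ≤ c f) (hS : S.Nonempty)
    (hM : ∀ f ∈ S, n * c f - B f ≤ M) (k : ℕ) :
    ∀ (j : ℕ) (a : ι → ℝ), j + k = n → Admissible c j a → gameValue S B φ k a ≤ M := by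
  have := hS.to_subtype
  induction k with
  | zero =>
    intro j a hj ha
    obtain rfl : j = n := by simpa using hj
    exact ciSup_le (le_of_admissible hM ha)
  | succ k ih =>
    intro j a hj ha
    refine ciSup_le fun x => ?_
    have h1 := ih (j + 1) _ (by omega) (ha.add (hφ x))
    have h2 := ih (j + 1) _ (by omega) (ha.sub (hφ x))
    linarith

theorem le_gameValue_zero {a : ι → ℝ} (hM : ∀ f ∈ S, n * c f - B f ≤ M)
    (ha : Admissible c n a) {f : ι} (hf : f ∈ S) : a f - B f ≤ gameValue S B φ 0 a :=
  le_ciSup (f := fun f : S => a f - B f) ⟨M, Set.forall_mem_range.2 (le_of_admissible hM ha)⟩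
    ⟨f, hf⟩

theorem average_le_gameValue_succ [Nonempty X] (hφ : ∀ x f, |φ x f| ≤ c f) (hS : S.Nonempty)
    (hM : ∀ f ∈ S, n * c f - B f ≤ M) {j k : ℕ} {a : ι → ℝ} (hj : j + (k + 1) = n)
    (ha : Admissible c j a) (x : X) :
    (gameValue S B φ k (a + φ x) + gameValue S B φ k (a - φ x)) / 2
      ≤ gameValue S B φ (k + 1) a := by
  refine le_ciSup (f := fun x => (gameValue S B φ k (a + φ x) + gameValue S B φ k (a - φ x)) / 2)
    ⟨M, Set.forall_mem_range.2 fun x => ?_⟩ x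
  have h1 := gameValue_le hφ hS hM k (j + 1) _ (by omega) (ha.add (hφ x))
  have h2 := gameValue_le hφ hS hM k (j + 1) _ (by omega) (ha.sub (hφ x))
  linarith

/-- Suprema and averages are monotone and commute with adding constants. The bounds through `c` and
`M` keep all the real suprema genuine. -/
theorem gameValue_le_add [Nonempty X] (hφ : ∀ x f, |φ x f| ≤ c f) (hS : S.Nonempty)
    (hM : ∀ f ∈ S, n * c f - B f ≤ M) (k : ℕ) :
    ∀ (j : ℕ) (a b : ι → ℝ) (m : ℝ), j + k = n → Admissible c j b → (∀ f ∈ S, a f ≤ b f + m) →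
      gameValue S B φ k a ≤ gameValue S B φ k b + m := by
  have := hS.to_subtype
  induction k with
  | zero =>
    intro j a b m hj hb hab
    obtain rfl : j = n := by simpa using hj
    refine ciSup_le fun f => ?_
    have h1 := le_gameValue_zero (φ := φ) hM hb f.2
    have h2 := hab f f.2
    linarith
  | succ k ih =>
    intro j a b m hj hb hab
    refine ciSup_le fun x => ?_
    have h1 := ih (j + 1) (a + φ x) (b + φ x) m (by omega) (hb.add (hφ x)) fun f hf => by
      have := hab f hf
      simp only [Pi.add_apply]
      linarith
    have h2 := ih (j + 1) (a - φ x) (b - φ x) m (by omega) (hb.sub (hφ x)) fun f hf => by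
      have := hab f hf
      simp only [Pi.sub_apply]
      linarith
    have h3 := average_le_gameValue_succ hφ hS hM hj hb x
    linarith

/-- The final payoff is a supremum of affine functions of the gains, and averaging over translates
and taking suprema preserve convexity. -/
theorem gameValue_convex [Nonempty X] (hφ : ∀ x f, |φ x f| ≤ c f) (hS : S.Nonempty)
    (hM : ∀ f ∈ S, n * c f - B f ≤ M) {u v : ℝ} (hu : 0 ≤ u) (hv : 0 ≤ v) (huv : u + v = 1)
    (k : ℕ) :
    ∀ (j : ℕ) (a b : ι → ℝ), j + k = n → Admissible c j a → Admissible c j b →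
      gameValue S B φ k (u • a + v • b) ≤ u * gameValue S B φ k a + v * gameValue S B φ k b := by
  have := hS.to_subtype
  have huv' : v = 1 - u := by linarith
  induction k with
  | zero =>
    intro j a b hj ha hb
    obtain rfl : j = n := by simpa using hj
    refine ciSup_le fun f => ?_
    have h1 := mul_le_mul_of_nonneg_left (le_gameValue_zero (φ := φ) hM ha f.2) hu
    have h2 := mul_le_mul_of_nonneg_left (le_gameValue_zero (φ := φ) hM hb f.2) hv
    have h3 : B f = u * B f + v * B f := by rw [← add_mul, huv, one_mul]
    simp only [Pi.add_apply, Pi.smul_apply, smul_eq_mul]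
    linarith
  | succ k ih =>
    intro j a b hj ha hb
    refine ciSup_le fun x => ?_
    have h1 := ih (j + 1) (a + φ x) (b + φ x) (by omega) (ha.add (hφ x)) (hb.add (hφ x))
    have h2 := ih (j + 1) (a - φ x) (b - φ x) (by omega) (ha.sub (hφ x)) (hb.sub (hφ x))
    have e1 : u • a + v • b + φ x = u • (a + φ x) + v • (b + φ x) := by
      funext f
      simp only [Pi.add_apply, Pi.smul_apply, smul_eq_mul, huv']
      ring
    have e2 : u • a + v • b - φ x = u • (a - φ x) + v • (b - φ x) := by
      funext f
      simp only [Pi.add_apply, Pi.sub_apply, Pi.smul_apply, smul_eq_mul, huv']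
      ring
    rw [e1, e2]
    have h3 := mul_le_mul_of_nonneg_left (average_le_gameValue_succ hφ hS hM hj ha x) hu
    have h4 := mul_le_mul_of_nonneg_left (average_le_gameValue_succ hφ hS hM hj hb x) hv
    linarith

/-- The value along the segment between the two extreme outcomes of a round lies below the chord. -/
theorem gameValue_sub_smul_le [Nonempty X] (hφ : ∀ x f, |φ x f| ≤ c f) (hS : S.Nonempty)
    (hM : ∀ f ∈ S, n * c f - B f ≤ M) {j k : ℕ} {a : ι → ℝ} (hj : j + (k + 1) = n)
    (ha : Admissible c j a) (x : X) {s : ℝ} (hs : |s| ≤ 1) :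
    s * ((gameValue S B φ k (a + φ x) - gameValue S B φ k (a - φ x)) / 2)
      + gameValue S B φ k (a - s • φ x) ≤ gameValue S B φ (k + 1) a := by
  obtain ⟨hs1, hs2⟩ := abs_le.1 hs
  have h := gameValue_convex hφ hS hM (u := (1 - s) / 2) (v := (1 + s) / 2) (by linarith)
    (by linarith) (by ring) k (j + 1) _ _ (by omega) (ha.add (hφ x)) (ha.sub (hφ x))
  have e : ((1 - s) / 2) • (a + φ x) + ((1 + s) / 2) • (a - φ x) = a - s • φ x := by
    funext f
    simp only [Pi.add_apply, Pi.sub_apply, Pi.smul_apply, smul_eq_mul]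
    ring
  rw [e] at h
  have h3 := average_le_gameValue_succ hφ hS hM hj ha x
  linarith

theorem gameValue_add_le_sub_add [Nonempty X] (hφ : ∀ x f, |φ x f| ≤ c f) (hS : S.Nonempty)
    (hM : ∀ f ∈ S, n * c f - B f ≤ M) {j k : ℕ} {a : ι → ℝ} (hj : j + (k + 1) = n)
    (ha : Admissible c j a) (x : X) {m : ℝ} (hm : ∀ f ∈ S, φ x f ≤ m) :
    gameValue S B φ k (a + φ x) ≤ gameValue S B φ k (a - φ x) + 2 * m :=
  gameValue_le_add hφ hS hM k (j + 1) _ _ _ (by omega) (ha.sub (hφ x)) fun f hf => by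
    have := hm f hf
    simp only [Pi.add_apply, Pi.sub_apply]
    linarith

theorem gameValue_sub_le_add_add [Nonempty X] (hφ : ∀ x f, |φ x f| ≤ c f) (hS : S.Nonempty)
    (hM : ∀ f ∈ S, n * c f - B f ≤ M) {j k : ℕ} {a : ι → ℝ} (hj : j + (k + 1) = n)
    (ha : Admissible c j a) (x : X) {m : ℝ} (hm : ∀ f ∈ S, m ≤ φ x f) :
    gameValue S B φ k (a - φ x) ≤ gameValue S B φ k (a + φ x) - 2 * m := by
  rw [sub_eq_add_neg _ (2 * m)]
  refine gameValue_le_add hφ hS hM k (j + 1) _ _ _ (by omega) (ha.add (hφ x)) fun f hf => ?_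
  have := hm f hf
  simp only [Pi.add_apply, Pi.sub_apply]
  linarith

/-- Concentration: the exponential moment of the value grows by a bounded factor per round. -/
theorem exp_gameValue_average_le [Nonempty X] (hφ : ∀ x f, |φ x f| ≤ c f) (hS : S.Nonempty)
    (hM : ∀ f ∈ S, n * c f - B f ≤ M) {j k : ℕ} {a : ι → ℝ} (hj : j + (k + 1) = n)
    (ha : Admissible c j a) (x : X) {C t : ℝ} (hC : ∀ f ∈ S, c f ≤ C) (ht : 0 ≤ t) :
    (Real.exp (t * gameValue S B φ k (a + φ x)) + Real.exp (t * gameValue S B φ k (a - φ x))) / 2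
      ≤ Real.exp (t * gameValue S B φ (k + 1) a + t ^ 2 * C ^ 2 / 2) := by
  set p := gameValue S B φ k (a + φ x)
  set q := gameValue S B φ k (a - φ x)
  have h1 : p ≤ q + 2 * C := gameValue_add_le_sub_add hφ hS hM hj ha x fun f hf =>
    (abs_le.1 (hφ x f)).2.trans (hC f hf)
  have h2 : q ≤ p - 2 * (-C) := gameValue_sub_le_add_add hφ hS hM hj ha x fun f hf =>
    (neg_le_neg (hC f hf)).trans (abs_le.1 (hφ x f)).1
  have h3 := average_le_gameValue_succ hφ hS hM hj ha x
  -- Mean times fluctuation: the half difference is at most `C` in absolute value, and `cosh u ≤ exp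
  -- (u ^ 2 / 2)`.
  have e : (Real.exp (t * p) + Real.exp (t * q)) / 2
      = Real.exp (t * ((p + q) / 2)) * Real.cosh (t * ((p - q) / 2)) := by
    rw [Real.cosh_eq, mul_div_assoc', mul_add, ← Real.exp_add, ← Real.exp_add]
    ring_nf
  rw [e, Real.exp_add]
  refine mul_le_mul (Real.exp_le_exp.2 (mul_le_mul_of_nonneg_left h3 ht))
    ((Real.cosh_le_exp_half_sq _).trans (Real.exp_le_exp.2 ?_)) (Real.cosh_pos _).le
    (Real.exp_pos _).le
  have h4 : ((p - q) / 2) ^ 2 ≤ C ^ 2 := sq_le_sq' (by linarith) (by linarith)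
  rw [mul_pow]
  gcongr

/-- The scale of the class is at most of the order of its value divided by `√n`. -/
theorem abs_mul_sqrt_le_gameValue [Nonempty X] (hφ : ∀ x f, |φ x f| ≤ c f)
    (hM : ∀ f ∈ S, n * c f - (0 : ι → ℝ) f ≤ M) {f₀ f : ι} (hf₀ : f₀ ∈ S)
    (h0 : ∀ x, φ x f₀ = 0) (hf : f ∈ S) (hn : 0 < n) (x : X) :
    |φ x f| * √n ≤ 8 * gameValue S 0 φ n 0 := by
  have hn' : (0 : ℝ) < √n := Real.sqrt_pos.2 (by exact_mod_cast hn)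
  have hsq : √(n : ℝ) ^ 2 = n := Real.sq_sqrt (by positivity)
  set w := √(n : ℝ)
  -- Nature repeats `x`, so the coefficient `s` performs a simple random walk `S`. The payoff is at
  -- least `max 0 (s * φ x f)`, and `|s| ≥ w * (u ^ 2 - u ^ 4 / 4)` for `u = s / w`. The bracket is
  -- the mean of this polynomial, by `E (s + S_k)^2 = s^2 + k` and `E (s + S_k)^4 = s^4 + 6ks^2 +
  -- 3k^2 - 2k`.
  have key : ∀ k j : ℕ, j + k = n → ∀ s : ℝ, |s| ≤ j →
      s * φ x f / 2 + |φ x f| / 2 * (w * ((s ^ 2 + k) / w ^ 2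
        - (s ^ 4 + 6 * k * s ^ 2 + 3 * k ^ 2 - 2 * k) / (4 * w ^ 4)))
        ≤ gameValue S 0 φ k (s • φ x) := by
    have hadm : ∀ (j : ℕ) (s : ℝ), |s| ≤ j → Admissible c j (s • φ x) := fun j s hs f => by
      rw [Pi.smul_apply, smul_eq_mul, abs_mul]
      exact mul_le_mul hs (hφ x f) (abs_nonneg _) (by positivity)
    intro k
    induction k with
    | zero =>
      intro j hj s hs
      obtain rfl : j = n := by simpa using hj
      have h1 := le_gameValue_zero (φ := φ) hM (hadm _ s hs) hf
      have h2 := le_gameValue_zero (φ := φ) hM (hadm _ s hs) hf₀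
      simp only [Pi.smul_apply, smul_eq_mul, h0, Pi.zero_apply, sub_zero, mul_zero] at h1 h2
      have h3 : s * φ x f / 2 + |φ x f| / 2 * |s| ≤ gameValue S 0 φ 0 (s • φ x) := by
        have : |φ x f| / 2 * |s| = |s * φ x f| / 2 := by rw [abs_mul]; ring
        rw [this]
        rcases abs_cases (s * φ x f) with ⟨h, -⟩ | ⟨h, -⟩ <;> rw [h] <;> linarith
      refine le_trans ?_ h3
      gcongr
      have h5 : ∀ u : ℝ, 0 ≤ u → u ^ 2 - u ^ 4 / 4 ≤ u := fun u hu => by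
        have : 0 ≤ 1 - u + u ^ 3 / 4 := by
          nlinarith [mul_nonneg hu (sq_nonneg (u - 1)), sq_nonneg (u - 1)]
        nlinarith [mul_nonneg hu this]
      have h6 := h5 (|s| / w) (by positivity)
      rw [div_pow, div_pow, sq_abs, show |s| ^ 4 = s ^ 4 by
        rw [show (4 : ℕ) = 2 * 2 from rfl, pow_mul, sq_abs, ← pow_mul]] at h6
      have h7 := mul_le_mul_of_nonneg_left h6 hn'.le
      rw [mul_div_cancel₀ _ hn'.ne'] at h7
      refine le_trans (le_of_eq ?_) h7
      push_cast
      ring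
    | succ k ih =>
      intro j hj s hs
      have hj' : j + 1 + k = n := by omega
      have hs1 : |s + 1| ≤ ((j + 1 : ℕ) : ℝ) := by
        push_cast; exact (abs_add_le _ _).trans (by simpa using hs)
      have hs2 : |s - 1| ≤ ((j + 1 : ℕ) : ℝ) := by
        push_cast; exact (abs_sub _ _).trans (by simpa using hs)
      have h1 := ih _ hj' (s + 1) hs1
      have h2 := ih _ hj' (s - 1) hs2
      have h3 := average_le_gameValue_succ hφ ⟨f, hf⟩ hM hj (hadm j s hs) x
      rw [add_smul, one_smul] at h1
      rw [sub_smul, one_smul] at h2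
      refine le_trans (le_of_eq ?_) ((div_le_div_of_nonneg_right (add_le_add h1 h2)
        zero_le_two).trans h3)
      push_cast
      ring
  have h := key n 0 (by simp) 0 (by simp)
  rw [zero_smul] at h
  refine le_trans ?_ (mul_le_mul_of_nonneg_left h (by norm_num : (0 : ℝ) ≤ 8))
  have hw4 : w ^ 4 = (n : ℝ) ^ 2 := by rw [← hsq]; ring
  have hnn : (0 : ℝ) < n := by exact_mod_cast hn
  have hb : (1 : ℝ) / 4 ≤ ((0 : ℝ) ^ 2 + n) / w ^ 2
        - ((0 : ℝ) ^ 4 + 6 * n * (0 : ℝ) ^ 2 + 3 * (n : ℝ) ^ 2 - 2 * n) / (4 * w ^ 4) := by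
    rw [hsq, hw4]
    have e : ((0 : ℝ) ^ 2 + n) / n
        - ((0 : ℝ) ^ 4 + 6 * n * (0 : ℝ) ^ 2 + 3 * (n : ℝ) ^ 2 - 2 * n) / (4 * (n : ℝ) ^ 2)
        = 1 / 4 + 1 / (2 * n) := by
      field_simp
      ring
    rw [e]
    have : 0 ≤ 1 / (2 * (n : ℝ)) := by positivity
    linarith
  have hb' := mul_le_mul_of_nonneg_left hb (mul_nonneg (abs_nonneg (φ x f)) hn'.le)
  nlinarith [hb']

end GameValue

/-! ### Exponential potential over the levels, and the learner's decision -/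

section Potential

variable {ι X : Type*} {c : ι → ℝ} {φ : X → ι → ℝ} {B : ι → ℝ} {M : ℝ} {n : ℕ}

/-- The value of the game with competitors from all levels is at most the sum over the levels of
the exponential potentials of the unpenalised values. -/
theorem ofReal_gameValue_le_tsum [Nonempty X] [Nonempty ι] (lvl : ι → ℕ) {C θ t : ℕ → ℝ}
    (hlvl : ∀ i, (lvl ⁻¹' {i}).Nonempty) (ht : ∀ i, 0 < t i)
    (hφ : ∀ x f, |φ x f| ≤ C (lvl f))
    (hM : ∀ f ∈ (Set.univ : Set ι), n * C (lvl f) - θ (lvl f) ≤ M) (k : ℕ) :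
    ∀ (j : ℕ) (a : ι → ℝ), j + k = n → Admissible (fun f => C (lvl f)) j a →
      ENNReal.ofReal (gameValue Set.univ (fun f => θ (lvl f)) φ k a) ≤
        ∑' i, ENNReal.ofReal ((t i)⁻¹ * Real.exp (t i * (gameValue (lvl ⁻¹' {i}) 0 φ k a - θ i)
          + k * (t i ^ 2 * C i ^ 2 / 2))) := by
  have hMi : ∀ i, ∀ f ∈ lvl ⁻¹' {i}, n * C (lvl f) - (0 : ι → ℝ) f ≤ n * C i := by
    rintro i f hf
    rw [Set.mem_preimage, Set.mem_singleton_iff] at hf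
    simp [hf]
  have hCi : ∀ i, ∀ f ∈ lvl ⁻¹' {i}, C (lvl f) ≤ C i := by
    rintro i f hf
    rw [Set.mem_preimage, Set.mem_singleton_iff] at hf
    simp [hf]
  induction k with
  | zero =>
    intro j a hj ha
    obtain rfl : j = n := by simpa using hj
    set T := ∑' i, ENNReal.ofReal ((t i)⁻¹ * Real.exp (t i * (gameValue (lvl ⁻¹' {i}) 0 φ 0 a - θ i)
          + ((0 : ℕ) : ℝ) * (t i ^ 2 * C i ^ 2 / 2))) with hT
    rcases eq_or_ne T ⊤ with h | h
    · rw [h]; exact le_top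
    rw [ENNReal.ofReal_le_iff_le_toReal h]
    refine ciSup_le fun f => ?_
    rw [← ENNReal.ofReal_le_iff_le_toReal h, hT]
    refine le_trans ?_ (ENNReal.le_tsum (lvl f))
    refine ENNReal.ofReal_le_ofReal ?_
    have h1 := le_gameValue_zero (φ := φ) (hMi (lvl f)) ha (f := f) rfl
    simp only [Pi.zero_apply, sub_zero] at h1
    -- One term of the sum already suffices, since `u ≤ t⁻¹ * exp (t * u)`.
    rw [Nat.cast_zero, zero_mul, add_zero, inv_mul_eq_div, le_div_iff₀ (ht _)]
    refine le_trans ?_ ((le_add_of_nonneg_right zero_le_one).trans (Real.add_one_le_exp _))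
    rw [mul_comm]
    exact mul_le_mul_of_nonneg_left (by linarith) (ht _).le
  | succ k ih =>
    intro j a hj ha
    set T := ∑' i, ENNReal.ofReal ((t i)⁻¹ * Real.exp (t i *
          (gameValue (lvl ⁻¹' {i}) 0 φ (k + 1) a - θ i)
          + ((k + 1 : ℕ) : ℝ) * (t i ^ 2 * C i ^ 2 / 2))) with hT
    rcases eq_or_ne T ⊤ with h | h
    · rw [h]; exact le_top
    rw [ENNReal.ofReal_le_iff_le_toReal h]
    refine ciSup_le fun x => ?_
    rw [← ENNReal.ofReal_le_iff_le_toReal h, hT]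
    have h1 := ih (j + 1) _ (by omega) (ha.add (hφ x))
    have h2 := ih (j + 1) _ (by omega) (ha.sub (hφ x))
    rw [ENNReal.ofReal_div_of_pos two_pos]
    refine (ENNReal.div_le_div_right (ENNReal.ofReal_add_le.trans (add_le_add h1 h2)) _).trans ?_
    rw [← ENNReal.tsum_add, div_eq_mul_inv, ← ENNReal.tsum_mul_right]
    refine ENNReal.tsum_le_tsum fun i => ?_
    rw [← div_eq_mul_inv, ← ENNReal.ofReal_add
      (mul_nonneg (inv_nonneg.2 (ht i).le) (Real.exp_pos _).le)
      (mul_nonneg (inv_nonneg.2 (ht i).le) (Real.exp_pos _).le), ← ENNReal.ofReal_div_of_pos two_pos]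
    refine ENNReal.ofReal_le_ofReal ?_
    rw [← mul_add, mul_div_assoc]
    refine mul_le_mul_of_nonneg_left ?_ (inv_nonneg.2 (ht i).le)
    have h3 := exp_gameValue_average_le hφ (hlvl i) (hMi i) hj ha x (hCi i) (ht i).le
    set s := Real.exp (-(t i * θ i) + k * (t i ^ 2 * C i ^ 2 / 2))
    have h4 := mul_le_mul_of_nonneg_right h3 (Real.exp_pos
      (-(t i * θ i) + k * (t i ^ 2 * C i ^ 2 / 2))).le
    rw [← Real.exp_add, div_mul_eq_mul_div, add_mul, ← Real.exp_add, ← Real.exp_add] at h4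
    refine le_trans (le_of_eq ?_) (h4.trans (le_of_eq ?_))
    · congr 3 <;> ring
    · congr 1
      push_cast
      ring

/-- The learner has a decision which, up to `δ`, keeps the value from growing. -/
theorem exists_decision [Nonempty X] [Nonempty ι] {D : Set ℝ} (hD : Convex ℝ D)
    (pred : ι → X → D) (f₀ : X → D)
    (hφ : ∀ x f, |φ x f| ≤ c f) (hφD : ∀ x f, φ x f = pred f x - f₀ x)
    (hM : ∀ f ∈ (Set.univ : Set ι), n * c f - B f ≤ M) {δ : ℝ} (hδ : 0 < δ)
    {j k : ℕ} {a : ι → ℝ} (hj : j + (k + 1) = n) (ha : Admissible c j a) (x : X) :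
    ∃ d : D, ∀ s : ℝ, |s| ≤ 1 →
      s * ((d : ℝ) - f₀ x) + gameValue Set.univ B φ k (a - s • φ x)
        ≤ gameValue Set.univ B φ (k + 1) a + δ := by
  set g := (gameValue Set.univ B φ k (a + φ x) - gameValue Set.univ B φ k (a - φ x)) / 2 with hg
  -- If all of `D` were below `f₀ x + g - δ`, every gain `φ x f` would be at most `g - δ`, and the
  -- two extreme values would differ by less than `2 * g`; similarly from above. Otherwise `D` has
  -- points on both sides, and convexity gives the point itself.
  have near : ∃ d : D, |(d : ℝ) - (f₀ x + g)| ≤ δ := by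
    by_contra! hcon
    have hup : ∃ d ∈ D, f₀ x + g ≤ d := by
      by_contra! h
      have := gameValue_add_le_sub_add hφ Set.univ_nonempty hM hj ha x (m := g - δ) fun f _ => by
        have h1 := hcon (pred f x)
        have h2 := h _ (pred f x).2
        rw [abs_of_neg (by linarith)] at h1
        rw [hφD]
        linarith
      linarith
    have hdown : ∃ d ∈ D, d ≤ f₀ x + g := by
      by_contra! h
      have := gameValue_sub_le_add_add hφ Set.univ_nonempty hM hj ha x (m := g + δ) fun f _ => by
        have h1 := hcon (pred f x)
        have h2 := h _ (pred f x).2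
        rw [abs_of_pos (by linarith)] at h1
        rw [hφD]
        linarith
      linarith
    obtain ⟨u, hu, hu'⟩ := hup
    obtain ⟨v, hv, hv'⟩ := hdown
    have := hcon ⟨f₀ x + g, hD.ordConnected.out hv hu ⟨hv', hu'⟩⟩
    simp only [sub_self, abs_zero] at this
    linarith
  obtain ⟨d, hd⟩ := near
  refine ⟨d, fun s hs => ?_⟩
  have h1 := gameValue_sub_smul_le hφ Set.univ_nonempty hM hj ha x hs
  have h2 : s * (d - (f₀ x + g)) ≤ δ := by
    refine (le_abs_self _).trans ?_
    rw [abs_mul]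
    exact (mul_le_of_le_one_left (abs_nonneg _) hs).trans hd
  rw [← hg] at h1
  linarith

end Potential

/-! ### Subgradients -/

/-- A convex Lipschitz function has bounded subgradients, at end points of its domain too. -/
theorem exists_subgradient {D : Set ℝ} {h : ℝ → ℝ} {L : ℝ≥0} (hc : ConvexOn ℝ D h)
    (hL : LipschitzOnWith L h D) (d : D) :
    ∃ s : ℝ, |s| ≤ 1 ∧ ∀ f : D, h d - h f ≤ L * (s * ((d : ℝ) - f)) := by
  have lip : ∀ u v : D, |h u - h v| ≤ L * |(u : ℝ) - v| := fun u v => by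
    simpa [Real.dist_eq] using hL.dist_le_mul u u.2 v v.2
  rcases eq_or_ne L 0 with rfl | hL0
  · refine ⟨0, by simp, fun f => ?_⟩
    have := (le_abs_self _).trans (lip d f)
    simpa using this
  have hLpos : (0 : ℝ) < L := by exact_mod_cast pos_iff_ne_zero.2 hL0
  -- The supremum of the slopes to the left is the left derivative; inserting `-L` covers a left end
  -- point, where there are no such slopes.
  set T : Set ℝ := insert (-(L : ℝ)) {m | ∃ f : D, (f : ℝ) < d ∧ m = (h d - h f) / (d - f)} with hT
  have hle : ∀ m ∈ T, m ≤ L := by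
    rintro m (rfl | ⟨f, hf, rfl⟩)
    · linarith
    · rw [div_le_iff₀ (sub_pos.2 hf)]
      have := (le_abs_self _).trans (lip d f)
      rwa [abs_of_pos (sub_pos.2 hf)] at this
  have hne : T.Nonempty := ⟨_, Set.mem_insert _ _⟩
  have hb : BddAbove T := ⟨L, hle⟩
  have h1 : sSup T ≤ L := csSup_le hne hle
  have h2 : -(L : ℝ) ≤ sSup T := le_csSup hb (Set.mem_insert _ _)
  refine ⟨sSup T / L, ?_, fun f => ?_⟩
  · rw [abs_div, abs_of_pos hLpos, div_le_one hLpos]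
    exact abs_le.2 ⟨h2, h1⟩
  rw [← mul_assoc, mul_div_cancel₀ _ hLpos.ne']
  rcases lt_trichotomy (f : ℝ) d with hfd | hfd | hfd
  · have : (h d - h f) / (d - f) ≤ sSup T := le_csSup hb (Or.inr ⟨f, hfd, rfl⟩)
    rwa [div_le_iff₀ (sub_pos.2 hfd)] at this
  · simp [hfd]
  · have : sSup T ≤ (h f - h d) / (f - d) := by
      refine csSup_le hne ?_
      rintro m (rfl | ⟨e, he, rfl⟩)
      · rw [le_div_iff₀ (sub_pos.2 hfd)]
        have := (neg_abs_le _).trans' (neg_le_neg (lip f d))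
        rw [abs_of_pos (sub_pos.2 hfd)] at this
        linarith
      · exact hc.slope_mono_adjacent e.2 f.2 he hfd
    rw [le_div_iff₀ (sub_pos.2 hfd)] at this
    linarith

/-! ### From a bound on the value to a strategy -/

section Strategy

variable {ι X Y : Type*} {D : Set ℝ}

/-- The gains of the linearised losses, for the decision rule `dec` and the slopes `sub`. -/
def linearState (n : ℕ) (φ : X → ι → ℝ) (dec : ℕ → (ι → ℝ) → X → D) (sub : D → Y → ℝ)
    (x : ℕ → X) (y : ℕ → Y) : ℕ → ι → ℝ
  | 0 => 0
  | t + 1 => linearState n φ dec sub x y t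
      - sub (dec (n - (t + 1)) (linearState n φ dec sub x y t) (x t)) (y t) • φ (x t)

/-- Non-anticipation: the state can be computed from the observed prefix, so the decision rule is a
legitimate strategy. -/
theorem linearState_congr (n : ℕ) (φ : X → ι → ℝ) (dec : ℕ → (ι → ℝ) → X → D) (sub : D → Y → ℝ)
    {x x' : ℕ → X} {y y' : ℕ → Y} {t : ℕ} (hx : ∀ i < t, x i = x' i) (hy : ∀ i < t, y i = y' i) :
    linearState n φ dec sub x y t = linearState n φ dec sub x' y' t := by
  induction t with
  | zero => rfl
  | succ t ih =>
    rw [linearState, linearState, ih (fun i hi => hx i (by omega)) (fun i hi => hy i (by omega)),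
      hx t (by omega), hy t (by omega)]

/-- A finite sequence continued by an arbitrary constant. -/
def extendSeq {A : Type*} [Nonempty A] {t : ℕ} (s : Fin t → A) (i : ℕ) : A :=
  if h : i < t then s ⟨i, h⟩ else Classical.arbitrary A

/-- The learner plays point masses. Linearised loss so far plus remaining value grows by at most `δ`
per round, and the final value dominates the penalised gain of every competitor. -/
theorem exists_strategy_of_gameValue_le [Nonempty X] [Nonempty Y] [Nonempty ι]
    {loss : D → Y → ℝ} {L : ℝ≥0} {c : ι → ℝ} {φ : X → ι → ℝ} {B : ι → ℝ} {M V δ : ℝ} {n : ℕ}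
    (hD : Convex ℝ D)
    (hsub : ∀ (d : D) (y : Y), ∃ s : ℝ, |s| ≤ 1 ∧
      ∀ f : D, loss d y - loss f y ≤ L * (s * ((d : ℝ) - f)))
    (pred : ι → X → D) (f₀ : X → D)
    (hφ : ∀ x f, |φ x f| ≤ c f) (hφD : ∀ x f, φ x f = pred f x - f₀ x)
    (hM : ∀ f ∈ (Set.univ : Set ι), n * c f - B f ≤ M) (hδ : 0 < δ)
    (hV : gameValue Set.univ B φ n 0 ≤ V) :
    ∃ q : Strategy n X D Y, ∀ (x : Fin n → X) (y : Fin n → Y),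
      (∀ t : Fin n, MeasureTheory.Integrable (fun d => loss d (y t)) (q.play x y t)) ∧
      ∀ f : ι, (∑ t : Fin n, ∫ d, loss d (y t) ∂(q.play x y t))
        - ∑ t : Fin n, loss (pred f (x t)) (y t) ≤ L * (V + n * δ + B f) := by
  choose sub hsub1 hsub2 using hsub
  -- The decision is a total function of the state; at unreachable states it is `f₀ x` by default.
  have hdec : ∀ (k : ℕ) (a : ι → ℝ) (x : X), ∃ d : D, ∀ j, j + (k + 1) = n → Admissible c j a →
      ∀ s : ℝ, |s| ≤ 1 → s * ((d : ℝ) - f₀ x) + gameValue Set.univ B φ k (a - s • φ x)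
        ≤ gameValue Set.univ B φ (k + 1) a + δ := by
    intro k a x
    by_cases h : ∃ j, j + (k + 1) = n ∧ Admissible c j a
    · obtain ⟨j, hj, ha⟩ := h
      obtain ⟨d, hd⟩ := exists_decision hD pred f₀ hφ hφD hM hδ hj ha x
      exact ⟨d, fun _ _ _ => hd⟩
    · exact ⟨f₀ x, fun j hj ha => (h ⟨j, hj, ha⟩).elim⟩
  choose dec hdec using hdec
  refine ⟨fun t hx hy => ⟨MeasureTheory.Measure.dirac (dec (n - (t + 1))
    (linearState n φ dec sub (extendSeq hx) (extendSeq hy) t) (hx (Fin.last t))),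
    MeasureTheory.Measure.dirac.isProbabilityMeasure⟩, fun x y => ?_⟩
  set x' : ℕ → X := extendSeq x
  set y' : ℕ → Y := extendSeq y
  have hx' : ∀ t : Fin n, x' t = x t := fun t => by simp [x', extendSeq]
  have hy' : ∀ t : Fin n, y' t = y t := fun t => by simp [y', extendSeq]
  set st := linearState n φ dec sub x' y' with hst
  set d : ℕ → D := fun t => dec (n - (t + 1)) (st t) (x' t) with hd
  set s : ℕ → ℝ := fun t => sub (d t) (y' t) with hs
  have hst1 : ∀ t, st (t + 1) = st t - s t • φ (x' t) := fun t => rfl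
  have hplay : ∀ t : Fin n, Strategy.play (fun t hx hy => ⟨MeasureTheory.Measure.dirac
      (dec (n - (t + 1)) (linearState n φ dec sub (extendSeq hx) (extendSeq hy) t)
        (hx (Fin.last t))), MeasureTheory.Measure.dirac.isProbabilityMeasure⟩ : Strategy n X D Y)
        x y t = MeasureTheory.Measure.dirac (d t) := by
    intro t
    simp only [Strategy.play, MeasureTheory.ProbabilityMeasure.coe_mk]
    congr 1
    have e1 : linearState n φ dec sub (extendSeq (initialIncl x t)) (extendSeq (initial y t)) t
        = st t := by
      refine linearState_congr n φ dec sub (fun i hi => ?_) (fun i hi => ?_)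
      · have h1 : i < (t : ℕ) + 1 := by omega
        have h2 : i < n := by omega
        simp only [x', extendSeq, h1, h2, dif_pos, initialIncl]
        rfl
      · have h2 : i < n := by omega
        simp only [y', extendSeq, hi, h2, dif_pos, initial]
        rfl
    rw [e1, hd]
    simp only [hx']
    rfl
  refine ⟨fun t => ?_, fun f => ?_⟩
  · rw [hplay]
    exact MeasureTheory.integrable_dirac (by simp)
  simp only [hplay, MeasureTheory.integral_dirac]
  have hadm : ∀ t ≤ n, Admissible c t (st t) := by
    intro t
    induction t with
    | zero => exact fun _ => admissible_zero
    | succ t ih =>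
      intro ht
      rw [hst1]
      refine (ih (by omega)).sub fun f => ?_
      rw [Pi.smul_apply, smul_eq_mul, abs_mul]
      exact (mul_le_of_le_one_left (abs_nonneg _) (hsub1 _ _)).trans (hφ _ _)
  have hmain : ∀ t ≤ n, ∑ i ∈ Finset.range t, s i * ((d i : ℝ) - f₀ (x' i))
      + gameValue Set.univ B φ (n - t) (st t) ≤ V + t * δ := by
    intro t
    induction t with
    | zero =>
      intro _
      simpa [hst, linearState] using hV
    | succ t ih =>
      intro ht
      have h1 := ih (by omega)
      have h2 := hdec (n - (t + 1)) (st t) (x' t) t (by omega) (hadm t (by omega)) (s t)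
        (hsub1 _ _)
      rw [← hst1, show n - (t + 1) + 1 = n - t by omega] at h2
      rw [Finset.sum_range_succ]
      push_cast
      linarith
  have hstf : ∀ t, st t f = -∑ i ∈ Finset.range t, s i * φ (x' i) f := by
    intro t
    induction t with
    | zero => simp [hst, linearState]
    | succ t ih =>
      rw [hst1, Pi.sub_apply, ih, Finset.sum_range_succ, Pi.smul_apply, smul_eq_mul]
      ring
  have h1 := hmain n le_rfl
  rw [Nat.sub_self] at h1
  have h2 := le_gameValue_zero (φ := φ) hM (hadm n le_rfl) (Set.mem_univ f)
  rw [hstf] at h2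
  have h3 : ∑ i ∈ Finset.range n, s i * ((d i : ℝ) - pred f (x' i)) ≤ V + n * δ + B f := by
    have : ∑ i ∈ Finset.range n, s i * ((d i : ℝ) - pred f (x' i))
        = ∑ i ∈ Finset.range n, s i * ((d i : ℝ) - f₀ (x' i))
          - ∑ i ∈ Finset.range n, s i * φ (x' i) f := by
      rw [← Finset.sum_sub_distrib]
      refine Finset.sum_congr rfl fun i _ => ?_
      rw [hφD]
      ring
    linarith
  refine le_trans ?_ (mul_le_mul_of_nonneg_left h3 L.2)
  rw [← Finset.sum_sub_distrib, Finset.mul_sum, ← Fin.sum_univ_eq_sum_range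
    (fun i => (L : ℝ) * (s i * ((d i : ℝ) - pred f (x' i))))]
  refine Finset.sum_le_sum fun t _ => ?_
  rw [← hx', ← hy']
  exact hsub2 (d t) (y' t) (pred f (x' t))

end Strategy

/-! ### Trees and the unpenalised game -/

section Trees

variable {X : Type*} {n : ℕ}

/-- The tree with root `x` and the two subtrees `z`. -/
def SignTree.cons (x : X) (z : Bool → SignTree n X) : SignTree (n + 1) X :=
  Fin.cases (fun _ => x) fun t e => z (e ⟨0, Nat.succ_pos _⟩) t fun i => e i.succ

theorem SignTree.label_cons_zero (x : X) (z : Bool → SignTree n X) (ε : Fin (n + 1) → Bool) :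
    (SignTree.cons x z).label ε 0 = x := rfl

theorem SignTree.label_cons_succ (x : X) (z : Bool → SignTree n X) (b : Bool) (ε : Fin n → Bool)
    (t : Fin n) :
    (SignTree.cons x z).label (Fin.cons b ε : Fin (n + 1) → Bool) t.succ = (z b).label ε t := rfl

theorem abs_sgn (b : Bool) : |sgn b| = 1 := by cases b <;> simp [sgn]

theorem sum_bool_cons (u : (Fin (n + 1) → Bool) → ℝ) :
    ∑ ε, u ε = ∑ ε : Fin n → Bool, u (Fin.cons true ε) + ∑ ε : Fin n → Bool, u (Fin.cons false ε) := by
  rw [← (Fin.consEquiv fun _ : Fin (n + 1) => Bool).sum_comp u, Fintype.sum_prod_type,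
    Fintype.sum_bool]
  rfl

/-- The value of the unpenalised game is approximated by trees. -/
theorem exists_tree_gameValue_le {ι : Type*} [Nonempty X] {S : Set ι} {φ : X → ι → ℝ} {δ : ℝ} (hδ : 0 < δ)
    (k : ℕ) : ∀ a : ι → ℝ, ∃ z : SignTree k X, gameValue S 0 φ k a ≤
      (∑ ε : Fin k → Bool, ⨆ f : S, (a f + ∑ t : Fin k, sgn (ε t) * φ (z.label ε t) f)) / 2 ^ k
        + k * δ := by
  induction k with
  | zero =>
    intro a
    refine ⟨fun t => t.elim0, ?_⟩
    simp [gameValue]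
  | succ k ih =>
    intro a
    obtain ⟨x, hx⟩ : ∃ x, gameValue S 0 φ (k + 1) a - δ
        < (gameValue S 0 φ k (a + φ x) + gameValue S 0 φ k (a - φ x)) / 2 :=
      exists_lt_of_lt_ciSup (sub_lt_self _ hδ)
    obtain ⟨z1, h1⟩ := ih (a + φ x)
    obtain ⟨z2, h2⟩ := ih (a - φ x)
    refine ⟨SignTree.cons x fun b => if b then z1 else z2, ?_⟩
    rw [sum_bool_cons]
    simp only [Fin.sum_univ_succ, SignTree.label_cons_zero, SignTree.label_cons_succ, Fin.cons_zero,
      Fin.cons_succ, if_true, Bool.false_eq_true, if_false, ← add_assoc]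
    have e1 : ∀ f, (a + φ x) f = a f + sgn true * φ x f := fun f => by simp [sgn]
    have e2 : ∀ f, (a - φ x) f = a f + sgn false * φ x f := fun f => by simp [sgn, sub_eq_add_neg]
    simp only [e1] at h1
    simp only [e2] at h2
    push_cast
    rw [pow_succ, ← div_div, add_div]
    linarith

/-- The signs are orthogonal to every predictable sequence. -/
theorem sum_sgn_mul_label_eq_zero (z : SignTree n X) (g : X → ℝ) :
    ∑ ε : Fin n → Bool, ∑ t : Fin n, sgn (ε t) * g (z.label ε t) = 0 := by
  rw [Finset.sum_comm]
  refine Finset.sum_eq_zero fun t _ => ?_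
  -- Flipping the sign at time `t` reverses the summand, because the label at time `t` depends on
  -- earlier signs only.
  have hinv : Function.Involutive fun ε : Fin n → Bool => Function.update ε t (!ε t) := by
    intro ε
    simp
  let σ : Equiv.Perm (Fin n → Bool) := hinv.toPerm
  have h := Equiv.sum_comp σ fun ε => sgn (ε t) * g (z.label ε t)
  have h2 : ∀ ε : Fin n → Bool, sgn (σ ε t) * g (z.label (σ ε) t)
      = -(sgn (ε t) * g (z.label ε t)) := by
    intro ε
    have e1 : σ ε t = !ε t := by simp [σ, Function.Involutive.toPerm]
    have e2 : z.label (σ ε) t = z.label ε t := by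
      unfold SignTree.label
      congr 1
      funext i
      have : Fin.castLE t.isLt.le i ≠ t := fun hi => by
        have := congrArg Fin.val hi
        simp at this
        omega
      simp [σ, Function.Involutive.toPerm, initial, Function.update_of_ne this]
    rw [e1, e2]
    cases ε t <;> simp [sgn]
  simp only [h2, Finset.sum_neg_distrib] at h
  linarith

end Trees

/-! ### Bounds for the sequential Rademacher complexity -/

section Rademacher

variable {X : Type*} {n : ℕ} {G G' : Set (X → ℝ)} {b : ℝ}

theorem sum_sgn_mul_le (hG : ∀ g ∈ G, ∀ x, |g x| ≤ b) (z : SignTree n X) (ε : Fin n → Bool) (g : G) :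
    ∑ t : Fin n, sgn (ε t) * (g : X → ℝ) (z.label ε t) ≤ n * b := by
  refine (Finset.sum_le_card_nsmul Finset.univ _ b fun t _ => ?_).trans (by simp)
  refine (le_abs_self _).trans ?_
  rw [abs_mul, abs_sgn, one_mul]
  exact hG g g.2 _

theorem bddAbove_sum_sgn_mul (hG : ∀ g ∈ G, ∀ x, |g x| ≤ b) (z : SignTree n X) (ε : Fin n → Bool) :
    BddAbove (Set.range fun g : G => ∑ t : Fin n, sgn (ε t) * (g : X → ℝ) (z.label ε t)) :=
  ⟨n * b, Set.forall_mem_range.2 (sum_sgn_mul_le hG z ε)⟩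

theorem radTree_le (hne : G.Nonempty) (hG : ∀ g ∈ G, ∀ x, |g x| ≤ b) (z : SignTree n X) :
    radTree G z ≤ n * b := by
  have := hne.to_subtype
  rw [radTree, div_le_iff₀ (by positivity)]
  refine (Finset.sum_le_card_nsmul Finset.univ _ (n * b) fun ε _ =>
    ciSup_le (sum_sgn_mul_le hG z ε)).trans (le_of_eq ?_)
  simp
  ring

theorem radTree_le_rad (hne : G.Nonempty) (hG : ∀ g ∈ G, ∀ x, |g x| ≤ b) (z : SignTree n X) :
    radTree G z ≤ rad n G :=
  le_ciSup (f := fun z : SignTree n X => radTree G z)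
    ⟨n * b, Set.forall_mem_range.2 (radTree_le hne hG)⟩ z

theorem rad_mono [Nonempty X] (hne : G.Nonempty) (hGG' : G ⊆ G')
    (hG' : ∀ g ∈ G', ∀ x, |g x| ≤ b) : rad n G ≤ rad n G' := by
  have := hne.to_subtype
  have : Nonempty (SignTree n X) := ⟨fun _ _ => Classical.arbitrary X⟩
  refine ciSup_le fun z => le_trans ?_ (radTree_le_rad (hne.mono hGG') hG' z)
  unfold radTree
  gcongr with ε
  exact ciSup_le fun g => le_ciSup (f := fun g : G' => ∑ t : Fin n, sgn (ε t) *
    (g : X → ℝ) (z.label ε t)) (bddAbove_sum_sgn_mul hG' z ε) ⟨g, hGG' g.2⟩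

/-- The value of the unpenalised game against a class, centred at a fixed function, is at most the
Rademacher complexity of the class. -/
theorem gameValue_le_rad {ι : Type*} [Nonempty X] {S : Set ι} (hS : S.Nonempty) {φ : X → ι → ℝ}
    (p : ι → X → ℝ) (p₀ : X → ℝ) (hp : ∀ f ∈ S, p f ∈ G) (hφ : ∀ x f, φ x f = p f x - p₀ x)
    (hG : ∀ g ∈ G, ∀ x, |g x| ≤ b) : gameValue S 0 φ n 0 ≤ rad n G := by
  have := hS.to_subtype
  obtain ⟨f₁, hf₁⟩ := hS
  refine le_of_forall_pos_le_add fun δ hδ => ?_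
  have hδ' : 0 < δ / (n + 1) := by positivity
  obtain ⟨z, hz⟩ := exists_tree_gameValue_le (S := S) (φ := φ) hδ' n 0
  refine hz.trans (add_le_add (le_trans ?_ (radTree_le_rad ⟨_, hp f₁ hf₁⟩ hG z)) ?_)
  · unfold radTree
    refine div_le_div_of_nonneg_right ?_ (by positivity)
    -- Centring at `p₀` changes each path sum by a quantity of mean zero that does not depend on the
    -- competitor.
    have h0 := sum_sgn_mul_label_eq_zero z p₀
    rw [← sub_zero (∑ ε : Fin n → Bool, ⨆ g : G, ∑ t : Fin n, sgn (ε t) * (g : X → ℝ) (z.label ε t)),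
      ← h0, ← Finset.sum_sub_distrib]
    refine Finset.sum_le_sum fun ε _ => ciSup_le fun f => ?_
    have h1 := le_ciSup (f := fun g : G => ∑ t : Fin n, sgn (ε t) * (g : X → ℝ) (z.label ε t))
      (bddAbove_sum_sgn_mul hG z ε) ⟨p f, hp f f.2⟩
    simp only [hφ, mul_sub, Finset.sum_sub_distrib, Pi.zero_apply, zero_add]
    exact sub_le_sub_right h1 _
  · rw [mul_div_assoc', div_le_iff₀ (by positivity)]
    nlinarith

/-- The Rademacher complexity of a class is at least of the order of `√n` times its diameter. -/
theorem abs_sub_mul_sqrt_le_rad (hG : ∀ g ∈ G, ∀ x, |g x| ≤ b) (hn : 0 < n) {g h : X → ℝ}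
    (hg : g ∈ G) (hh : h ∈ G) (x : X) : |g x - h x| * √n ≤ 8 * rad n G := by
  have : Nonempty X := ⟨x⟩
  let φ : X → G → ℝ := fun x f => (f : X → ℝ) x - h x
  have hφ : ∀ x f, |φ x f| ≤ b + b := fun x f =>
    (abs_sub _ _).trans (add_le_add (hG f f.2 x) (hG h hh x))
  refine (abs_mul_sqrt_le_gameValue (S := Set.univ) (c := fun _ => b + b) (M := n * (b + b))
    (f₀ := ⟨h, hh⟩) (f := ⟨g, hg⟩) hφ (fun f _ => by simp) trivial (fun x => sub_self _) trivial hn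
    x).trans (mul_le_mul_of_nonneg_left ?_ (by norm_num))
  exact gameValue_le_rad ⟨⟨g, hg⟩, Set.mem_univ _⟩ (fun f : G => (f : X → ℝ)) h (fun f _ => f.2)
    (fun _ _ => rfl) hG

end Rademacher

/-! ### Consequences of the covering hypothesis -/

section Covering

variable {X : Type*} {n : ℕ} {G : Set (X → ℝ)}

/-- A class with one value per instance has covering numbers at most one. -/
theorem covering_le_one (hG : ∀ g ∈ G, ∀ h ∈ G, g = h) {α : ℝ} (hα : 0 ≤ α) :
    covering G α n ≤ 1 := by
  refine iSup_le fun z => ?_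
  by_cases hne : G.Nonempty
  · obtain ⟨g, hg⟩ := hne
    let v : SignTree n ℝ := fun t e => g (z t e)
    refine (iInf₂_le {v} fun h hh ε => ⟨v, rfl, fun t => ?_⟩).trans (Set.encard_singleton v).le
    rw [hG h hh g hg]
    simpa [v, SignTree.label] using hα
  · refine (iInf₂_le ∅ fun g hg => (hne ⟨g, hg⟩).elim).trans (by simp)

theorem coveringSum_eq_top (hG : ∀ g ∈ G, ∀ h ∈ G, g = h) : coveringSum G n = ⊤ := by
  rw [coveringSum, eq_top_iff]
  calc (⊤ : ℝ≥0∞) = ∑' _ : ℕ, (1 : ℝ≥0∞) := (ENNReal.tsum_const_eq_top_of_ne_zero one_ne_zero).symm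
    _ ≤ _ := ENNReal.tsum_le_tsum fun j => by
      rw [ENNReal.one_le_inv]
      have := covering_le_one (n := n) hG (α := ((2 : ℝ) ^ (j + 1))⁻¹) (by positivity)
      exact_mod_cast this

/-- Bounded classes have finite covering numbers. -/
theorem covering_lt_top {b : ℝ} (hG : ∀ g ∈ G, ∀ x, |g x| ≤ b) {α : ℝ} (hα : 0 < α) :
    covering G α n < ⊤ := by
  obtain ⟨K, hK, hcov⟩ : ∃ K : Set ℝ, K.Finite ∧ ∀ u : ℝ, |u| ≤ b → ∃ v ∈ K, |u - v| ≤ α := by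
    obtain ⟨K, hK, hcov⟩ :=
      Metric.totallyBounded_iff.1 (isCompact_Icc (a := -b) (b := b)).totallyBounded α hα
    refine ⟨K, hK, fun u hu => ?_⟩
    obtain ⟨v, hv, huv⟩ := Set.mem_iUnion₂.1 (hcov (Set.mem_Icc.2 (abs_le.1 hu)))
    exact ⟨v, hv, (Metric.mem_ball.1 huv).le⟩
  -- The cover consists of the trees with values in the finite net `K` that depend on time but not
  -- on the path.
  set V : Set (SignTree n ℝ) := (fun (v : Fin n → ℝ) t _ => v t) '' Set.univ.pi fun _ => K
  have hV : V.Finite := (Set.Finite.pi fun _ => hK).image _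
  refine lt_of_le_of_lt (iSup_le fun z => ?_) hV.encard_lt_top
  refine iInf₂_le V fun g hg ε => ?_
  choose v hvK hv using fun t : Fin n => hcov (g (z.label ε t)) (hG g hg _)
  exact ⟨_, ⟨v, fun t _ => hvK t, rfl⟩, hv⟩

theorem coveringSum_pos {b : ℝ} (hG : ∀ g ∈ G, ∀ x, |g x| ≤ b) : 0 < coveringSum G n := by
  refine lt_of_lt_of_le ?_ (ENNReal.le_tsum 0)
  rw [ENNReal.inv_pos]
  have := covering_lt_top (n := n) hG (α := ((2 : ℝ) ^ (0 + 1))⁻¹) (by positivity)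
  simpa using this.ne

end Covering

/-! ### Calibration of the levels -/

/-- The inverse temperature (relative to the scale `r`) of a level of index `m`. -/
def levelTemp (r₀ r m : ℝ) : ℝ := √(1 + Real.log (r / r₀) + 2 * Real.log m)

section Level

variable {r₀ r m : ℝ}

theorem levelTemp_sq (h0 : 0 < r₀) (hr : r₀ ≤ r) (hm : 1 ≤ m) :
    levelTemp r₀ r m ^ 2 = 1 + Real.log (r / r₀) + 2 * Real.log m := by
  have h1 : 0 ≤ Real.log (r / r₀) := Real.log_nonneg ((one_le_div h0).2 hr)
  have h2 : 0 ≤ Real.log m := Real.log_nonneg hm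
  exact Real.sq_sqrt (by linarith)

theorem one_le_levelTemp (h0 : 0 < r₀) (hr : r₀ ≤ r) (hm : 1 ≤ m) : 1 ≤ levelTemp r₀ r m := by
  have h1 : 0 ≤ Real.log (r / r₀) := Real.log_nonneg ((one_le_div h0).2 hr)
  have h2 : 0 ≤ Real.log m := Real.log_nonneg hm
  exact Real.one_le_sqrt.2 (by linarith)

/-- The variance term equals `32 * η ^ 2` and the penalty contributes at most `-33 * η ^ 2`. The
remaining `-η ^ 2` pays for the factors `r₀ / r` and `1 / m ^ 2`. -/
theorem level_potential_le {V : ℝ} {n : ℕ} (hn : 0 < n) (h0 : 0 < r₀) (hr : r₀ ≤ r) (hm : 1 ≤ m)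
    (hV : V ≤ r) :
    (levelTemp r₀ r m / r)⁻¹ * Real.exp (levelTemp r₀ r m / r *
      (V - r * (1 + 33 * levelTemp r₀ r m))
        + n * ((levelTemp r₀ r m / r) ^ 2 * (8 * r / √n) ^ 2 / 2)) ≤ r₀ * (1 / m ^ 2) := by
  have hη := one_le_levelTemp h0 hr hm
  have hsq := levelTemp_sq h0 hr hm
  set η := levelTemp r₀ r m
  have hr' : 0 < r := h0.trans_le hr
  have hn' : (0 : ℝ) < n := by exact_mod_cast hn
  have hm' : 0 < m := by linarith
  have e1 : n * ((η / r) ^ 2 * (8 * r / √n) ^ 2 / 2) = 32 * η ^ 2 := by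
    rw [div_pow, div_pow, Real.sq_sqrt hn'.le]
    field_simp
    ring
  have e2 : η / r * (V - r * (1 + 33 * η)) ≤ -33 * η ^ 2 := by
    have : η / r * (V - r * (1 + 33 * η)) ≤ η / r * (r - r * (1 + 33 * η)) := by
      gcongr
    refine this.trans (le_of_eq ?_)
    field_simp
    ring
  have e3 : Real.exp (η / r * (V - r * (1 + 33 * η)) + n * ((η / r) ^ 2 * (8 * r / √n) ^ 2 / 2))
      ≤ r₀ / r * (1 / m ^ 2) := by
    have h1 : Real.exp (-(Real.log (r / r₀) + 2 * Real.log m)) = r₀ / r * (1 / m ^ 2) := by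
      rw [neg_add, Real.exp_add, Real.exp_neg, Real.exp_log (by positivity), inv_div, Real.exp_neg,
        two_mul, Real.exp_add, Real.exp_log hm', one_div, sq]
    rw [← h1, e1]
    exact Real.exp_le_exp.2 (by linarith)
  rw [inv_div]
  calc r / η * Real.exp _ ≤ r * (r₀ / r * (1 / m ^ 2)) :=
        mul_le_mul (div_le_self hr'.le hη) e3 (Real.exp_pos _).le hr'.le
    _ = r₀ * (1 / m ^ 2) := by field_simp

/-- This bound is uniform in the level, which makes the supremum over all levels finite. If `√n ≤ η`
the penalty exceeds all possible gains; otherwise `log (r / r₀) ≤ n`. -/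
theorem level_payoff_le {n : ℕ} (hn : 0 < n) (h0 : 0 < r₀) (hr : r₀ ≤ r) (hm : 1 ≤ m) :
    n * (8 * r / √n) - r * (1 + 33 * levelTemp r₀ r m) ≤ 8 * √n * (r₀ * Real.exp n) := by
  have hη := one_le_levelTemp h0 hr hm
  have hsq := levelTemp_sq h0 hr hm
  set η := levelTemp r₀ r m
  have hr' : 0 < r := h0.trans_le hr
  have hn' : (0 : ℝ) < n := by exact_mod_cast hn
  have e1 : n * (8 * r / √n) = 8 * √n * r := by
    nth_rewrite 1 [← Real.mul_self_sqrt hn'.le]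
    have : √(n : ℝ) ≠ 0 := (Real.sqrt_pos.2 hn').ne'
    field_simp
  rw [e1]
  rcases le_total (√(n : ℝ)) η with h | h
  · have h1 : 8 * √n * r ≤ r * (1 + 33 * η) := by nlinarith
    have h2 : 0 ≤ 8 * √n * (r₀ * Real.exp n) := by positivity
    linarith
  · have h1 : η ^ 2 ≤ n := by
      rw [← Real.sq_sqrt hn'.le]
      gcongr
    have h2 : Real.log (r / r₀) ≤ n := by
      have := Real.log_nonneg hm
      linarith
    have h3 : r ≤ r₀ * Real.exp n := by
      rw [Real.log_le_iff_le_exp (by positivity), div_le_iff₀ h0] at h2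
      linarith
    have h4 : 8 * √n * r ≤ 8 * √n * (r₀ * Real.exp n) := by gcongr
    have h5 : 0 ≤ r * (1 + 33 * η) := by positivity
    linarith

/-- The index satisfies `(i + 1) * log 2 ≤ log (2 * R)`, so `log (i + 1)` costs only `log log (2R)`
and a constant. The constant is `68 = 1 + 33 * 2 + 1`. -/
theorem level_rate_le {ρ R S : ℝ} {i : ℕ} (h0 : 0 < r₀) (hr : r₀ ≤ r) (hρ : r ≤ ρ) (hS : 0 ≤ S)
    (hi : (2 : ℝ) ^ (i + 1) ≤ 2 * R) :
    r * (1 + 33 * levelTemp r₀ r (i + 1)) + (S + 1) * r₀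
      ≤ (S + 68) * ρ * (1 + √(Real.log (ρ / r₀) + Real.log (Real.log (2 * R)))) := by
  have hr' : 0 < r := h0.trans_le hr
  set w := Real.log (ρ / r₀) + Real.log (Real.log (2 * R))
  have hlog2 : 0 < Real.log 2 := Real.log_pos one_lt_two
  have h1 : Real.log (i + 1) ≤ Real.log (Real.log (2 * R)) + 1 / 2 := by
    have h2 : ((i : ℝ) + 1) * Real.log 2 ≤ Real.log (2 * R) := by
      have := Real.log_le_log (by positivity) hi
      rw [Real.log_pow] at this
      exact_mod_cast this
    have h3 := Real.log_le_log (by positivity) h2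
    rw [Real.log_mul (by positivity) hlog2.ne'] at h3
    have h4 : -(1 / 2) ≤ Real.log (Real.log 2) := by
      have h5 := Real.one_sub_inv_le_log_of_pos hlog2
      have h6 : (Real.log 2)⁻¹ ≤ 3 / 2 := by
        rw [inv_le_comm₀ hlog2 (by norm_num)]
        linarith [Real.log_two_gt_d9]
      linarith
    linarith
  have h2 : Real.log (r / r₀) ≤ Real.log (ρ / r₀) := by
    have : 0 < r / r₀ := by positivity
    gcongr
  have h2' : 0 ≤ Real.log (ρ / r₀) := Real.log_nonneg ((one_le_div h0).2 (hr.trans hρ))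
  have hη : levelTemp r₀ r (i + 1) ≤ 2 * (1 + √w) := by
    refine Real.sqrt_le_iff.2 ⟨by positivity, ?_⟩
    -- For `w < 0` the root is `0` and the inequality is still true.
    have h3 : w ≤ √w ^ 2 := by
      rcases le_total 0 w with h | h
      · rw [Real.sq_sqrt h]
      · exact h.trans (sq_nonneg _)
    have h4 := Real.sqrt_nonneg w
    have h5 : Real.log (ρ / r₀) + Real.log (Real.log (2 * R)) = w := rfl
    nlinarith
  have hw := Real.sqrt_nonneg w
  have hη0 : 0 ≤ levelTemp r₀ r (i + 1) := Real.sqrt_nonneg _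
  have hρ0 : 0 < ρ := hr'.trans_le hρ
  have h6 : r * (1 + 33 * levelTemp r₀ r (i + 1)) ≤ ρ * (1 + 33 * (2 * (1 + √w))) := by gcongr
  have h7 : (S + 1) * r₀ ≤ (S + 1) * ρ := by
    have := hr.trans hρ
    gcongr
  nlinarith [mul_nonneg (mul_nonneg hρ0.le hw) hS, mul_nonneg hρ0.le hw]

end Level

/-! ### Aggregation of the dyadic levels -/

/-- The infimum `R(f)` need not be attained, so the dyadic level is chosen strictly above it: `2 ^ i
≤ R(f) < 2 ^ (i + 1)`. -/
theorem exists_level {X D : Type*} {F : ℝ → Set (X → D)} (hF : MonotoneOn F (Set.Ici 1))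
    {f : X → D} (hf : f ∈ unionClass F) :
    ∃ i : ℕ, f ∈ F (2 ^ (i + 1)) ∧ (2 : ℝ) ^ (i + 1) ≤ 2 * radius F f := by
  obtain ⟨R₁, hR₁, hfR₁⟩ : ∃ R : ℝ, 1 ≤ R ∧ f ∈ F R := by
    simpa [unionClass] using hf
  have hne : {R : ℝ | 1 ≤ R ∧ f ∈ F R}.Nonempty := ⟨R₁, hR₁, hfR₁⟩
  have h1 : 1 ≤ radius F f := le_csInf hne fun R hR => hR.1
  obtain ⟨i, hi1, hi2⟩ := exists_nat_pow_near h1 one_lt_two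
  refine ⟨i, ?_, by rw [pow_succ]; linarith⟩
  obtain ⟨R, ⟨hR, hfR⟩, hlt⟩ := exists_lt_of_csInf_lt hne hi2
  exact hF hR (hR.trans hlt.le) hlt.le hfR

theorem realClass_mono {X : Type*} {D : Set ℝ} {F G : Set (X → D)} (h : F ⊆ G) :
    realClass F ⊆ realClass G := Set.image_mono h

/-- The aggregation of all levels: a strategy whose regret against the level `i` is of the order
of the complexity of this level, up to the level temperature. -/
theorem exists_strategy_levels {X : Type*} {D Y : Set ℝ} [Nonempty Y] {loss : ℝ → ℝ → ℝ}
    {L : ℝ≥0} {F : ℕ → Set (X → D)} {n : ℕ} {r₀ : ℝ}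
    (hconv : ∀ y ∈ Y, ConvexOn ℝ D fun d => loss d y)
    (hlip : ∀ y ∈ Y, LipschitzOnWith L (fun d => loss d y) D)
    (hb : ∀ i, ∃ b : ℝ, ∀ f ∈ F i, ∀ x : X, |(f x : ℝ)| ≤ b) (hn : 0 < n)
    {f₀ : X → D} (hf₀ : ∀ i, f₀ ∈ F i) (hr₀ : 0 < r₀) (hr : ∀ i, r₀ ≤ rad n (realClass (F i))) :
    ∃ q : Strategy n X D Y, ∀ (x : Fin n → X) (y : Fin n → Y),
      (∀ t : Fin n, MeasureTheory.Integrable (fun d : D => loss d (y t)) (q.play x y t)) ∧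
      ∀ i, ∀ f ∈ F i, (∑ t : Fin n, ∫ d : D, loss d (y t) ∂(q.play x y t))
        - ∑ t : Fin n, loss (f (x t)) (y t) ≤
          L * (rad n (realClass (F i)) * (1 + 33 * levelTemp r₀ (rad n (realClass (F i))) (i + 1))
            + ((∑' i : ℕ, 1 / ((i : ℝ) + 1) ^ 2) + 1) * r₀) := by
  have hb' : ∀ i, ∃ b : ℝ, ∀ g ∈ realClass (F i), ∀ x : X, |g x| ≤ b := fun i => by
    obtain ⟨b, h⟩ := hb i
    exact ⟨b, by rintro _ ⟨f, hf, rfl⟩ x; exact h f hf x⟩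
  have hX : Nonempty X := by
    by_contra hX
    have := not_nonempty_iff.1 hX
    have : IsEmpty (SignTree n X) := ⟨fun z => isEmptyElim (z ⟨0, hn⟩ fun _ => true)⟩
    have h := hr 0
    rw [rad, Real.iSup_of_isEmpty] at h
    linarith
  set r : ℕ → ℝ := fun i => rad n (realClass (F i))
  -- A predictor occurs once for each level containing it, each time with the penalty of that level.
  let ι := Σ i : ℕ, F i
  have : Nonempty ι := ⟨⟨0, f₀, hf₀ 0⟩⟩
  let lvl : ι → ℕ := Sigma.fst
  let pred : ι → X → D := fun f => f.2
  let φ : X → ι → ℝ := fun x f => pred f x - f₀ x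
  have hlvl : ∀ i, (lvl ⁻¹' {i}).Nonempty := fun i => ⟨⟨i, f₀, hf₀ i⟩, rfl⟩
  have hVr : ∀ i, gameValue (lvl ⁻¹' {i}) 0 φ n 0 ≤ r i := by
    intro i
    obtain ⟨b, hbi⟩ := hb' i
    refine gameValue_le_rad (hlvl i) (fun f x => pred f x) (fun x => f₀ x) ?_ (fun _ _ => rfl) hbi
    rintro ⟨_, f⟩ rfl
    exact ⟨f, f.2, rfl⟩
  have hnpos : (0 : ℝ) < √n := Real.sqrt_pos.2 (by exact_mod_cast hn)
  choose b hb using hb'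
  have hφ : ∀ x f, |φ x f| ≤ 8 * r (lvl f) / √n := by
    rintro x ⟨i, f⟩
    rw [le_div_iff₀ hnpos]
    exact abs_sub_mul_sqrt_le_rad (hb i) hn ⟨f, f.2, rfl⟩ ⟨f₀, hf₀ i, rfl⟩ x
  have hm : ∀ i : ℕ, (1 : ℝ) ≤ i + 1 := fun i => by
    have : (0 : ℝ) ≤ i := i.cast_nonneg
    linarith
  let θ : ℕ → ℝ := fun i => r i * (1 + 33 * levelTemp r₀ (r i) (i + 1))
  let t : ℕ → ℝ := fun i => levelTemp r₀ (r i) (i + 1) / r i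
  have hM : ∀ f ∈ (Set.univ : Set ι), n * (8 * r (lvl f) / √n) - θ (lvl f)
      ≤ 8 * √n * (r₀ * Real.exp n) := fun f _ => level_payoff_le hn hr₀ (hr _) (hm _)
  have ht : ∀ i, 0 < t i := fun i =>
    div_pos (zero_lt_one.trans_le (one_le_levelTemp hr₀ (hr i) (hm i))) (hr₀.trans_le (hr i))
  have hsum : Summable fun i : ℕ => 1 / ((i : ℝ) + 1) ^ 2 := by
    have := (summable_nat_add_iff 1).2 (Real.summable_one_div_nat_pow.2 one_lt_two)
    simpa using this
  have hV : gameValue Set.univ (fun f => θ (lvl f)) φ n 0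
      ≤ (∑' i : ℕ, 1 / ((i : ℝ) + 1) ^ 2) * r₀ := by
    have hnn : 0 ≤ (∑' i : ℕ, 1 / ((i : ℝ) + 1) ^ 2) * r₀ :=
      mul_nonneg (tsum_nonneg fun i => by positivity) hr₀.le
    rw [← ENNReal.ofReal_le_ofReal_iff hnn]
    refine (ofReal_gameValue_le_tsum lvl (C := fun i => 8 * r i / √n) hlvl ht hφ hM n 0 0
      (zero_add n) admissible_zero).trans ?_
    rw [mul_comm, ← tsum_mul_left, ENNReal.ofReal_tsum_of_nonneg (fun i => by positivity)
      (hsum.mul_left _)]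
    exact ENNReal.tsum_le_tsum fun i => ENNReal.ofReal_le_ofReal
      (level_potential_le hn hr₀ (hr i) (hm i) (hVr i))
  obtain ⟨y₀⟩ := ‹Nonempty Y›
  have hnn : (0 : ℝ) < n := by exact_mod_cast hn
  -- The slack per round is `r₀ / n`, adding `r₀` in all.
  obtain ⟨q, hq⟩ := exists_strategy_of_gameValue_le (Y := Y) (loss := fun (d : D) (y : Y) => loss d y)
    (L := L) (hconv y₀ y₀.2).1
    (fun d y => exists_subgradient (hconv y y.2) (hlip y y.2) d) pred f₀ hφ (fun _ _ => rfl) hM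
    (div_pos hr₀ hnn) hV
  refine ⟨q, fun x y => ⟨(hq x y).1, fun i f hf => ((hq x y).2 ⟨i, f, hf⟩).trans (le_of_eq ?_)⟩⟩
  rw [mul_div_cancel₀ _ hnn.ne']
  simp only [θ, lvl]
  ring

end AdaptiveOnline

end

/-! ### The main theorem -/

open AdaptiveOnline in
theorem mainTheorem8 :
    ∃ K₁ K₂ : ℝ, 0 < K₁ ∧ 0 < K₂ ∧
      ∀ (X : Type*) (D Y : Set ℝ) (loss : ℝ → ℝ → ℝ) (L : ℝ≥0)
        (F : ℝ → Set (X → D)) (n : ℕ) (Γ : ℝ),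
        (∀ y ∈ Y, ConvexOn ℝ D (fun d => loss d y)) →
        (∀ y ∈ Y, LipschitzOnWith L (fun d => loss d y) D) →
        MonotoneOn F (Set.Ici 1) →
        (∀ R : ℝ, 1 ≤ R → ∃ b : ℝ, ∀ f ∈ F R, ∀ x : X, |(f x : ℝ)| ≤ b) →
        2 ≤ n →
        AdaptiveOnline.coveringSum (AdaptiveOnline.realClass (F 1)) n ≤ ENNReal.ofReal Γ →
        AdaptiveOnline.Achievable (n := n) (fun (d : D) (y : Y) => loss d y)
          (AdaptiveOnline.unionClass F)
          (fun f _ _ => (L : ℝ) * AdaptiveOnline.modelRate n K₁ K₂ Γ F f) := by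
  have hlog2 : 0 < Real.log 2 := Real.log_pos one_lt_two
  have hS : 0 ≤ ∑' i : ℕ, 1 / ((i : ℝ) + 1) ^ 2 := tsum_nonneg fun i => by positivity
  set S := ∑' i : ℕ, 1 / ((i : ℝ) + 1) ^ 2
  -- Dividing by `log^{3/2} 2` lets `log^{3/2} n`, for `n ≥ 2`, absorb the constant of
  -- `level_rate_le`.
  refine ⟨(S + 68) / Real.log 2 ^ (3 / 2 : ℝ), 1, by positivity, one_pos, ?_⟩
  intro X D Y loss L F n Γ hconv hlip hF hb hn hΓ
  have hb' : ∀ R : ℝ, 1 ≤ R → ∃ b : ℝ, ∀ g ∈ realClass (F R), ∀ x : X, |g x| ≤ b := fun R hR => by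
    obtain ⟨b, h⟩ := hb R hR
    exact ⟨b, by rintro _ ⟨f, hf, rfl⟩ x; exact h f hf x⟩
  obtain ⟨b₁, hb₁⟩ := hb' 1 le_rfl
  have hΓpos : 0 < Γ := ENNReal.ofReal_pos.1 ((coveringSum_pos hb₁).trans_le hΓ)
  -- With at most one predictor in `F 1`, every term of the covering sum is at least `1` and the sum
  -- diverges. Two predictors that differ somewhere make the Rademacher complexity positive.
  obtain ⟨f₀, hf₀, f₁, hf₁, hne⟩ : ∃ f₀ ∈ F 1, ∃ f₁ ∈ F 1, f₁ ≠ f₀ := by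
    by_contra! h
    have := coveringSum_eq_top (G := realClass (F 1)) (n := n) (by
      rintro _ ⟨f, hf, rfl⟩ _ ⟨g, hg, rfl⟩
      rw [h g hg f hf])
    rw [this, top_le_iff] at hΓ
    exact ENNReal.ofReal_ne_top hΓ
  obtain ⟨x₁, hx₁⟩ := Function.ne_iff.1 hne
  have hX : Nonempty X := ⟨x₁⟩
  rcases isEmpty_or_nonempty Y with hY | hY
  · exact ⟨fun _ _ _ => ⟨MeasureTheory.Measure.dirac (f₀ x₁),
      MeasureTheory.Measure.dirac.isProbabilityMeasure⟩, fun x y => isEmptyElim (y ⟨0, by omega⟩)⟩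
  have hpow : ∀ i : ℕ, (1 : ℝ) ≤ 2 ^ (i + 1) := fun i => one_le_pow₀ one_le_two
  have hsub : ∀ {R R' : ℝ}, 1 ≤ R → R ≤ R' → realClass (F R) ⊆ realClass (F R') :=
    fun hR h => realClass_mono (hF hR (hR.trans h) h)
  have hmono : ∀ {R R' : ℝ}, 1 ≤ R → R ≤ R' →
      rad n (realClass (F R)) ≤ rad n (realClass (F R')) := fun {R R'} hR h => by
    obtain ⟨b, hb⟩ := hb' R' (hR.trans h)
    exact rad_mono ⟨_, hsub le_rfl hR ⟨f₀, hf₀, rfl⟩⟩ (hsub hR h) hb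
  have hr₀ : 0 < rad n (realClass (F 1)) := by
    have h2 := abs_sub_mul_sqrt_le_rad (n := n) hb₁ (by omega) ⟨f₁, hf₁, rfl⟩ ⟨f₀, hf₀, rfl⟩ x₁
    have h3 : 0 < |(f₁ x₁ : ℝ) - f₀ x₁| :=
      abs_pos.2 (sub_ne_zero.2 fun h => hx₁ (Subtype.ext h))
    have h4 : (0 : ℝ) < √n := Real.sqrt_pos.2 (by exact_mod_cast (by omega : 0 < n))
    have h5 := mul_pos h3 h4
    linarith
  obtain ⟨q, hq⟩ := exists_strategy_levels (F := fun i : ℕ => F (2 ^ (i + 1))) hconv hlip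
    (fun i => hb _ (hpow i)) (by omega : 0 < n)
    (fun i => hF (Set.mem_Ici.2 le_rfl) (hpow i) (hpow i) hf₀) hr₀ (fun i => hmono le_rfl (hpow i))
  refine ⟨q, fun x y => ⟨(hq x y).1, fun f hf => ?_⟩⟩
  obtain ⟨i, hfi, hi⟩ := exists_level hF hf
  refine ((hq x y).2 i f hfi).trans (mul_le_mul_of_nonneg_left ?_ L.2)
  refine (level_rate_le hr₀ (hmono le_rfl (hpow i)) (hmono (hpow i) hi) hS hi).trans ?_
  have hlog : Real.log 2 ^ (3 / 2 : ℝ) ≤ Real.log n ^ (3 / 2 : ℝ) := by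
    have : (2 : ℝ) ≤ n := by exact_mod_cast hn
    gcongr
  have hlogpos : 0 < Real.log 2 ^ (3 / 2 : ℝ) := by positivity
  have hρ : 0 < rad n (realClass (F (2 * radius F f))) :=
    hr₀.trans_le (hmono le_rfl ((hpow i).trans hi))
  rw [modelRate]
  -- The first term alone is large enough; the `K₂` term is nonnegative.
  refine le_add_of_le_of_nonneg ?_ (by positivity)
  refine mul_le_mul_of_nonneg_right ?_ (by positivity)
  rw [div_mul_eq_mul_div, div_mul_eq_mul_div, le_div_iff₀ hlogpos]
  exact mul_le_mul_of_nonneg_left hlog (by positivity)
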